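/- Corollary 5.2. Let $k\ge 1$ be an integer and let $G$ be a finite simple graph of order $n$ with minimum degree $\delta\ge 2k+2$ and maximum degree $\Delta$. Let $D$ be the diagonal matrix of vertex degrees of $G$ and $A$ its adjacency matrix, and for real $a,b$ let $\lambda_i(aD+bA)$ denote the $i$-th largest eigenvalue (with multiplicity) of $aD+bA$. For a positive integer $d$, say that $G$ has property $P(k,d)$ if $G$ contains $k$ pairwise edge-disjoint spanning trees and a further forest $F$, edge-disjoint from all of them, with $|E(F)|>\frac{d-1}{d}(n-1)$, such that if $F$ is not a spanning tree of $G$, then some connected component of $F$ has at least $d$ edges. Let $a\ge 0$ and $b\ne 0$ be real numbers. Then $G$ has property $P(k,\delta)$ if one of the following conditions holds: (i) $\lambda_2(aD+A)<(a+1)\delta-\dfrac{2\left(k+\frac{\delta-1}{\delta}\right)}{\delta+1}$; (ii) $b>0$ and $\lambda_2(aD+bA)<(a+b)\delta-\dfrac{2b\left(k+\frac{\delta-1}{\delta}\right)}{\delta+1}$; (iii) $b<0$ and $\lambda_{n-1}(aD+bA)>a\Delta+b\delta-\dfrac{2b\left(k+\frac{\delta-1}{\delta}\right)}{\delta+1}$.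 -/

import Mathlib

/-- The real symmetric matrix `a D(G) + b A(G)`, where `D(G)` is the diagonal matrix of vertex
degrees and `A(G)` is the adjacency matrix. -/
def degAdjMatrix {V : Type*} [Fintype V] [DecidableEq V] (G : SimpleGraph V) [DecidableRel G.Adj]
    (a b : ℝ) : Matrix V V ℝ :=
  a • G.degMatrix ℝ + b • G.adjMatrix ℝ

theorem degAdjMatrix_isHermitian {V : Type*} [Fintype V] [DecidableEq V] (G : SimpleGraph V)
    [DecidableRel G.Adj] (a b : ℝ) : (degAdjMatrix G a b).IsHermitian := by
  rw [Matrix.IsHermitian, Matrix.conjTranspose_eq_transpose_of_trivial, degAdjMatrix,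
    Matrix.transpose_add, Matrix.transpose_smul, Matrix.transpose_smul,
    SimpleGraph.transpose_adjMatrix, SimpleGraph.degMatrix, Matrix.diagonal_transpose]

/-- The `i`-th largest eigenvalue, counted with multiplicity, of a real symmetric matrix `M` of
order `n`, for `1 ≤ i ≤ n`; for other `i` the value is `0` by convention.
(`Matrix.IsHermitian.eigenvalues₀` lists the eigenvalues in decreasing order, from index `0`.) -/
noncomputable def nthLargestEigenvalue {V : Type*} [Fintype V] [DecidableEq V] {M : Matrix V V ℝ}
    (hM : M.IsHermitian) (i : ℕ) : ℝ :=
  if h : 1 ≤ i ∧ i ≤ Fintype.card V then hM.eigenvalues₀ ⟨i - 1, by omega⟩ else 0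

/-- `λᵢ(G, a, b)`: the `i`-th largest eigenvalue of `a D(G) + b A(G)`. In particular
`lam G a 1 i` is the `i`-th largest eigenvalue `λᵢ(G, a)` of `a D(G) + A(G)`. -/
noncomputable def lam {V : Type*} [Fintype V] [DecidableEq V] (G : SimpleGraph V)
    [DecidableRel G.Adj] (a b : ℝ) (i : ℕ) : ℝ :=
  nthLargestEigenvalue (degAdjMatrix_isHermitian G a b) i

/-- Property `P(k, d)`: `G` contains `k` spanning trees `T 0, …, T (k - 1)` and a further forest
`F`, all pairwise edge-disjoint, such that `F` has more than `((d - 1) / d) (n - 1)` edges, and if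
`F` is not a spanning tree then some connected component of `F` has at least `d` edges.
Subgraphs are given by their edges on the full vertex set `V`. -/
def PropertyP {V : Type*} [Fintype V] (G : SimpleGraph V) (k d : ℕ) : Prop :=
  ∃ (T : Fin k → SimpleGraph V) (F : SimpleGraph V),
    (∀ i, T i ≤ G ∧ (T i).IsTree) ∧
    (∀ i j, i ≠ j → Disjoint (T i).edgeSet (T j).edgeSet) ∧
    F ≤ G ∧ F.IsAcyclic ∧
    (∀ i, Disjoint (T i).edgeSet F.edgeSet) ∧
    ((d : ℝ) - 1) / d * ((Fintype.card V : ℝ) - 1) < (F.edgeSet.ncard : ℝ) ∧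
    (¬ F.IsTree → ∃ c : F.ConnectedComponent, d ≤ c.toSimpleGraph.edgeSet.ncard)

/-! ### Counting and exchanging edges in forests. -/

namespace SimpleGraph

/-! Put c = k + (δ-1)/δ. The proof has a combinatorial and a spectral half, joined by one condition:
every partition of V into p ≥ 2 classes is crossed by more than c(p-1) edges.

Combinatorial half (`propertyP_of_forall_setoid`). Among all systems of k spanning trees and a
forest, take one with the largest forest and, among these, one in which the forest has a smallest
possible component C. Inserting uncovered edges and removing cycle edges in all possible ways
produces a tight partition: each tree and the forest is connected inside every class, and all
crossing edges are covered (`IsParetoMaximal.exists_isTight`). Counting along it bounds the forest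
from below. By minimality of C (`IsTreesAndForest.exists_smaller`) the partition stays tight when C
becomes one class. If all components had fewer than d edges, the count for this coarser partition
would contradict the condition.

Spectral half (`lt_ncard_of_lt_cross`). Write r(X) for the number of edges leaving X and e(X,Y) for
the number joining X to Y. By Courant-Fischer on the span of two indicator vectors, the eigenvalue
bound forces (2c-r(X))(2c-r(Y)) < e(X,Y)² for disjoint X, Y with more than δ vertices and r ≤ 2c.
Applying this to the class of least boundary and each other class, and summing, yields the
condition. -/

theorem IsAcyclic.ncard_edgeSet_add_card_connectedComponent {V : Type*} [Finite V]
    {H : SimpleGraph V} (hH : H.IsAcyclic) :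
    H.edgeSet.ncard + Nat.card H.ConnectedComponent = Nat.card V := by
  classical
  have := Fintype.ofFinite V
  -- Each component is a tree, so its degree sum is twice its order minus 2. Summing over the
  -- components gives the claim, doubled.
  have hdeg : ∀ c : H.ConnectedComponent,
      ∑ v with H.connectedComponentMk v = c, (H.degree v + 2) =
        2 * (Finset.univ.filter fun v ↦ H.connectedComponentMk v = c).card
          + 2 * (Finset.univ.filter fun v ↦ H.connectedComponentMk v = c).card - 2 := by
    intro c
    have h1 := (hH.isTree_connectedComponent c).card_edgeFinset
    have h2 := c.toSimpleGraph.sum_degrees_eq_twice_card_edges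
    have h3 : Fintype.card c = (Finset.univ.filter fun v ↦ H.connectedComponentMk v = c).card := by
      rw [Fintype.card_subtype]
      rfl
    have h4 : ∑ v : c, c.toSimpleGraph.degree v =
        ∑ v with H.connectedComponentMk v = c, H.degree v := by
      rw [Finset.sum_subtype (p := fun v ↦ v ∈ c) _ (fun v ↦ by simp; rfl)]
      refine Finset.sum_congr rfl fun v _ ↦ ?_
      rw [← card_neighborFinset_eq_degree, ← card_neighborFinset_eq_degree]
      refine Finset.card_bij (fun w _ ↦ w.1) ?_ ?_ ?_
      · intro w hw
        rw [mem_neighborFinset] at hw ⊢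
        exact (c.toSimpleGraph_adj v.2 w.2).1 hw
      · intro a _ b _ h
        exact Subtype.ext h
      · intro w hw
        rw [mem_neighborFinset] at hw
        have hv : H.connectedComponentMk v.1 = c := v.2
        have hwc : w ∈ c := (ConnectedComponent.sound hw.reachable.symm).trans hv
        exact ⟨⟨w, hwc⟩, by
          rw [mem_neighborFinset]; exact (c.toSimpleGraph_adj v.2 hwc).2 hw, rfl⟩
    rw [Finset.sum_add_distrib, ← h4, h2, Finset.sum_const, smul_eq_mul]
    omega
  have hpos : ∀ c : H.ConnectedComponent,
      1 ≤ (Finset.univ.filter fun v ↦ H.connectedComponentMk v = c).card := by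
    intro c
    induction c using ConnectedComponent.ind with
    | h v => exact Finset.card_pos.2 ⟨v, by simp⟩
  have hsum : ∑ c : H.ConnectedComponent,
      (Finset.univ.filter fun v ↦ H.connectedComponentMk v = c).card = Fintype.card V := by
    rw [← Finset.card_univ (α := V)]
    exact (Finset.card_eq_sum_card_fiberwise (f := H.connectedComponentMk)
      (fun _ _ ↦ Finset.mem_coe.2 (Finset.mem_univ _))).symm
  have htot : ∑ v, (H.degree v + 2) = ∑ c : H.ConnectedComponent,
      ∑ v with H.connectedComponentMk v = c, (H.degree v + 2) :=
    (Finset.sum_fiberwise _ _ _).symm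
  have h5 : ∑ c : H.ConnectedComponent,
      (∑ v with H.connectedComponentMk v = c, (H.degree v + 2) + 2) =
      ∑ c : H.ConnectedComponent,
        4 * (Finset.univ.filter fun v ↦ H.connectedComponentMk v = c).card := by
    refine Finset.sum_congr rfl fun c _ ↦ ?_
    have := hdeg c
    have := hpos c
    omega
  rw [Finset.sum_add_distrib, ← htot, ← Finset.mul_sum, hsum, Finset.sum_add_distrib,
    sum_degrees_eq_twice_card_edges, Finset.sum_const, Finset.sum_const, Finset.card_univ,
    Finset.card_univ] at h5
  simp only [smul_eq_mul] at h5
  rw [Set.ncard_eq_toFinset_card', Nat.card_eq_fintype_card, Nat.card_eq_fintype_card]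
  change H.edgeFinset.card + _ = _
  omega

variable {V : Type*} {T : SimpleGraph V}

/-- Remove the edge `g` and insert the edge `s(v, w)`. -/
def exchange (T : SimpleGraph V) (g : Sym2 V) (v w : V) : SimpleGraph V :=
  T.deleteEdges {g} ⊔ edge v w

theorem exchange_adj {g : Sym2 V} {v w x y : V} (hvw : v ≠ w) :
    (T.exchange g v w).Adj x y ↔ (T.Adj x y ∧ s(x, y) ≠ g) ∨ s(x, y) = s(v, w) := by
  rw [exchange, sup_adj, deleteEdges_adj, adj_edge, Set.mem_singleton_iff]
  refine or_congr Iff.rfl ⟨fun h ↦ h.1.symm, fun h ↦ ⟨h.symm, ?_⟩⟩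
  rintro rfl
  rw [Sym2.eq_iff] at h
  rcases h with ⟨rfl, rfl⟩ | ⟨rfl, rfl⟩ <;> exact hvw rfl

/-- Paths in a forest are unique, so a walk avoiding `g` would shorten to `p` itself, which uses
`g`. -/
theorem IsAcyclic.not_reachable_deleteEdges (hT : T.IsAcyclic) {v w : V} (p : T.Path v w)
    {g : Sym2 V} (hg : g ∈ p.1.edges) : ¬ (T.deleteEdges {g}).Reachable v w := by
  classical
  intro h
  induction g with
  | h x y =>
    obtain ⟨q, hq⟩ := reachable_deleteEdges_iff_exists_walk.1 h
    have hpq : p = q.toPath := (hT.subsingleton_path v w).elim _ _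
    exact hq (q.edges_toPath_subset_edges (hpq ▸ hg))

theorem IsAcyclic.exchange (hT : T.IsAcyclic) {g : Sym2 V} {v w : V}
    (h : ¬ (T.deleteEdges {g}).Reachable v w) : (T.exchange g v w).IsAcyclic :=
  (hT.anti (deleteEdges_le _)).sup_edge_of_not_reachable h

theorem ncard_edgeSet_sup_edge [Finite V] {v w : V} (hvw : v ≠ w) (h : ¬ T.Adj v w) :
    (T ⊔ edge v w).edgeSet.ncard = T.edgeSet.ncard + 1 := by
  rw [edgeSet_sup, edgeSet_edge_of_ne hvw, Set.union_singleton, Set.ncard_insert_of_notMem]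
  simpa using h

theorem ncard_edgeSet_exchange [Finite V] {g : Sym2 V} (hg : g ∈ T.edgeSet) {v w : V}
    (hvw : v ≠ w) (h : ¬ T.Adj v w) : (T.exchange g v w).edgeSet.ncard = T.edgeSet.ncard := by
  rw [SimpleGraph.exchange, ncard_edgeSet_sup_edge hvw fun h' ↦ h (deleteEdges_le _ h'),
    edgeSet_deleteEdges, Set.ncard_sdiff_singleton_add_one hg]

theorem IsAcyclic.isTree_of_card_le [Finite V] [Nonempty V] (hT : T.IsAcyclic)
    (h : Nat.card V ≤ T.edgeSet.ncard + 1) : T.IsTree := by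
  have h1 := hT.ncard_edgeSet_add_card_connectedComponent
  have h2 : Nat.card T.ConnectedComponent ≤ 1 := by omega
  have h3 : Subsingleton T.ConnectedComponent := Finite.card_le_one_iff_subsingleton.1 h2
  exact ⟨⟨fun x y ↦ ConnectedComponent.exact (Subsingleton.elim _ _)⟩, hT⟩

theorem IsTree.ncard_edgeSet_add_one [Finite V] (hT : T.IsTree) :
    T.edgeSet.ncard + 1 = Nat.card V := (isTree_iff_connected_and_card.1 hT).2

end SimpleGraph

/-! ### Exchanges in forest packings and tight partitions. -/

namespace SimpleGraph

variable {V ι : Type*}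

/-- A family of edge-disjoint forests in `G`. -/
structure IsForestPacking (G : SimpleGraph V) (F : ι → SimpleGraph V) : Prop where
  le : ∀ i, F i ≤ G
  isAcyclic : ∀ i, (F i).IsAcyclic
  disjoint : ∀ ⦃i j⦄, i ≠ j → ∀ ⦃x y⦄, (F i).Adj x y → ¬ (F j).Adj x y

/-- The disjoint union of complete graphs on the classes of `s`. -/
def classGraph (s : Setoid V) : SimpleGraph V where
  Adj x y := x ≠ y ∧ s x y
  symm := ⟨fun _ _ h ↦ ⟨h.1.symm, s.symm h.2⟩⟩
  loopless := ⟨fun _ h ↦ h.1 rfl⟩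

theorem Reachable.of_forall_adj {H : SimpleGraph V} {r : V → V → Prop} (hr : Equivalence r)
    (h : ∀ x y, H.Adj x y → r x y) {x y : V} (hxy : H.Reachable x y) : r x y := by
  obtain ⟨p⟩ := hxy
  induction p with
  | nil => exact hr.refl _
  | cons hadj _ ih => exact hr.trans (h _ _ hadj) ih

theorem Reachable.lift {H K : SimpleGraph V} (h : ∀ x y, H.Adj x y → K.Reachable x y) {x y : V}
    (hxy : H.Reachable x y) : K.Reachable x y :=
  hxy.of_forall_adj K.reachable_is_equivalence h

section

variable [DecidableEq ι] {G : SimpleGraph V} {F F' : ι → SimpleGraph V}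

/-- `F'` arises from `F` by successively inserting an edge of `G` not covered by the packing into
one of the forests and removing an edge of the cycle that this creates. -/
inductive ExchangeReachable (G : SimpleGraph V) (F : ι → SimpleGraph V) :
    (ι → SimpleGraph V) → Prop
  | refl : ExchangeReachable G F F
  | step {F' : ι → SimpleGraph V} (i : ι) {v w : V} (p : (F' i).Path v w) (g : Sym2 V) :
      ExchangeReachable G F F' → G.Adj v w → (∀ j, ¬ (F' j).Adj v w) → g ∈ p.1.edges →
      ExchangeReachable G F (Function.update F' i ((F' i).exchange g v w))

theorem IsForestPacking.exchange (hF : IsForestPacking G F) (i : ι) {v w : V}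
    (p : (F i).Path v w) {g : Sym2 V} (hvw : G.Adj v w) (hu : ∀ j, ¬ (F j).Adj v w)
    (hg : g ∈ p.1.edges) :
    IsForestPacking G (Function.update F i ((F i).exchange g v w)) := by
  have hnew : ∀ {x y}, ((F i).exchange g v w).Adj x y → (F i).Adj x y ∨ s(x, y) = s(v, w) := by
    intro x y h
    rw [exchange_adj hvw.ne] at h
    exact h.imp_left And.left
  have hdis : ∀ j, j ≠ i → ∀ x y, ((F i).exchange g v w).Adj x y → ¬ (F j).Adj x y := by
    intro j hj x y h h'
    rcases hnew h with h | h
    · exact hF.disjoint hj h' h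
    · exact hu j (((F j).adj_congr_of_sym2 h).1 h')
  refine ⟨fun j ↦ ?_, fun j ↦ ?_, fun j l hjl x y hj hl ↦ ?_⟩
  · rcases eq_or_ne j i with rfl | hj
    · rw [Function.update_self]
      intro x y h
      rcases hnew h with h | h
      · exact hF.le _ h
      · exact (G.adj_congr_of_sym2 h).2 hvw
    · rw [Function.update_of_ne hj]
      exact hF.le j
  · rcases eq_or_ne j i with rfl | hj
    · rw [Function.update_self]
      exact (hF.isAcyclic _).exchange ((hF.isAcyclic _).not_reachable_deleteEdges p hg)
    · rw [Function.update_of_ne hj]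
      exact hF.isAcyclic j
  · rcases eq_or_ne j i with rfl | hj'
    · rw [Function.update_self] at hj
      rw [Function.update_of_ne hjl.symm] at hl
      exact hdis l hjl.symm x y hj hl
    · rw [Function.update_of_ne hj'] at hj
      rcases eq_or_ne l i with rfl | hl'
      · rw [Function.update_self] at hl
        exact hdis j hjl x y hl hj
      · rw [Function.update_of_ne hl'] at hl
        exact hF.disjoint hjl hj hl

theorem ExchangeReachable.isForestPacking (h : ExchangeReachable G F F')
    (hF : IsForestPacking G F) : IsForestPacking G F' := by
  induction h with
  | refl => exact hF
  | step i p g _ hvw hu hg ih => exact ih.exchange i p hvw hu hg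

theorem ExchangeReachable.ncard_edgeSet [Finite V] (h : ExchangeReachable G F F') (j : ι) :
    (F' j).edgeSet.ncard = (F j).edgeSet.ncard := by
  induction h with
  | refl => rfl
  | step i p g _ hvw hu hg ih =>
    rcases eq_or_ne j i with rfl | hj
    · rw [Function.update_self,
        ncard_edgeSet_exchange (p.1.edges_subset_edgeSet hg) hvw.ne (hu _), ih]
    · rw [Function.update_of_ne hj, ih]

/-- A packing in which no forest can be enlarged without making another one smaller. -/
def IsParetoMaximal (G : SimpleGraph V) (F : ι → SimpleGraph V) : Prop :=
  ∀ F' : ι → SimpleGraph V, IsForestPacking G F' →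
    (∀ i, (F i).edgeSet.ncard ≤ (F' i).edgeSet.ncard) →
    ∀ i, (F' i).edgeSet.ncard ≤ (F i).edgeSet.ncard

/-- Exchanges preserve all sizes. If `v` and `w` were not joined in `F' i`, adding the edge there
would enlarge one forest and shrink none. -/
theorem IsParetoMaximal.reachable [Finite V] (hmax : IsParetoMaximal G F)
    (hF : IsForestPacking G F) (h : ExchangeReachable G F F') {v w : V} (hvw : G.Adj v w)
    (hu : ∀ j, ¬ (F' j).Adj v w) (i : ι) : (F' i).Reachable v w := by
  by_contra hnr
  have hF' := h.isForestPacking hF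
  have hcard := ncard_edgeSet_sup_edge hvw.ne (hu i)
  have hadj : ∀ {x y}, (F' i ⊔ edge v w).Adj x y → (F' i).Adj x y ∨ s(x, y) = s(v, w) := by
    intro x y h
    rw [sup_adj, adj_edge] at h
    exact h.imp_right fun h ↦ h.1.symm
  have hdis : ∀ j, j ≠ i → ∀ x y, (F' i ⊔ edge v w).Adj x y → ¬ (F' j).Adj x y := by
    intro j hj x y h h'
    rcases hadj h with h | h
    · exact hF'.disjoint hj h' h
    · exact hu j (((F' j).adj_congr_of_sym2 h).1 h')
  have key := hmax (Function.update F' i (F' i ⊔ edge v w)) ?_ ?_ i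
  · rw [Function.update_self, hcard, h.ncard_edgeSet] at key
    omega
  · refine ⟨fun j ↦ ?_, fun j ↦ ?_, fun j l hjl x y hj hl ↦ ?_⟩
    · rcases eq_or_ne j i with rfl | hj
      · rw [Function.update_self]
        exact sup_le (hF'.le _) ((edge_le_iff _).2 (.inr hvw))
      · rw [Function.update_of_ne hj]
        exact hF'.le j
    · rcases eq_or_ne j i with rfl | hj
      · rw [Function.update_self]
        exact (hF'.isAcyclic _).sup_edge_of_not_reachable hnr
      · rw [Function.update_of_ne hj]
        exact hF'.isAcyclic j
    · rcases eq_or_ne j i with rfl | hj'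
      · rw [Function.update_self] at hj
        rw [Function.update_of_ne hjl.symm] at hl
        exact hdis l hjl.symm x y hj hl
      · rw [Function.update_of_ne hj'] at hj
        rcases eq_or_ne l i with rfl | hl'
        · rw [Function.update_self] at hl
          exact hdis j hjl x y hl hj
        · rw [Function.update_of_ne hl'] at hl
          exact hF'.disjoint hjl hj hl
  · intro j
    rcases eq_or_ne j i with rfl | hj
    · rw [Function.update_self, hcard, h.ncard_edgeSet]
      omega
    · rw [Function.update_of_ne hj, h.ncard_edgeSet]

/-- The edges of `G` that are left uncovered by some packing reachable by exchanges from `F`. -/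
def exchangeGraph (G : SimpleGraph V) (F : ι → SimpleGraph V) : SimpleGraph V where
  Adj x y := ∃ F', ExchangeReachable G F F' ∧ G.Adj x y ∧ ∀ j, ¬ (F' j).Adj x y
  symm := ⟨fun _ _ ⟨F', h, hG, hu⟩ ↦ ⟨F', h, hG.symm, fun j hj ↦ hu j hj.symm⟩⟩
  loopless := ⟨fun _ ⟨_, _, hG, _⟩ ↦ hG.ne rfl⟩

/-- The path in a forest joining the ends of an uncovered edge lies in the exchange graph. -/
theorem ExchangeReachable.reachable_inf_exchangeGraph (h : ExchangeReachable G F F')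
    (hF : IsForestPacking G F) {v w : V} (hvw : G.Adj v w) (hu : ∀ j, ¬ (F' j).Adj v w) (i : ι)
    (p : (F' i).Path v w) : (F' i ⊓ exchangeGraph G F).Reachable v w := by
  refine ⟨p.1.transfer _ fun g hg ↦ ?_⟩
  rw [edgeSet_inf]
  refine ⟨p.1.edges_subset_edgeSet hg, ?_⟩
  have hF' := h.isForestPacking hF
  have hgi := p.1.edges_subset_edgeSet hg
  induction g with
  | h x y =>
    rw [mem_edgeSet] at hgi
    -- Exchanging this path edge for `s(v, w)` leaves it uncovered, which is what membership in the
    -- exchange graph requires.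
    refine ⟨_, h.step i p s(x, y) hvw hu hg, hF'.le i hgi, fun j ↦ ?_⟩
    rcases eq_or_ne j i with rfl | hj
    · rw [Function.update_self, exchange_adj hvw.ne]
      rintro (⟨_, h⟩ | h)
      · exact h rfl
      · exact hu _ (((F' _).adj_congr_of_sym2 h).1 hgi)
    · rw [Function.update_of_ne hj]
      exact hF'.disjoint hj.symm hgi

/-- Exchanges are undone one at a time: the inserted edge is replaced by the path it closed up,
which lies in the exchange graph. -/
theorem ExchangeReachable.reachable_of_reachable (h : ExchangeReachable G F F')
    (hF : IsForestPacking G F) (j : ι) {x y : V}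
    (hxy : (F' j ⊓ exchangeGraph G F).Reachable x y) :
    (F j ⊓ exchangeGraph G F).Reachable x y := by
  induction h generalizing x y with
  | refl => exact hxy
  | @step F' i v w p g hF' hvw hu hg ih =>
    apply ih
    rcases eq_or_ne j i with rfl | hj
    · rw [Function.update_self] at hxy
      refine hxy.lift fun a b hab ↦ ?_
      rw [inf_adj, exchange_adj hvw.ne] at hab
      obtain ⟨⟨h, _⟩ | h, hK⟩ := hab
      · exact Adj.reachable ⟨h, hK⟩
      · have := hF'.reachable_inf_exchangeGraph hF hvw hu j p
        rcases Sym2.eq_iff.1 h with ⟨rfl, rfl⟩ | ⟨rfl, rfl⟩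
        · exact this
        · exact this.symm
    · rwa [Function.update_of_ne hj] at hxy

/-- The classes of `s` induce connected subgraphs in every member of the family `F`, and every
edge of `G` between different classes is covered by `F`. -/
structure IsTight (G : SimpleGraph V) (F : ι → SimpleGraph V) (s : Setoid V) : Prop where
  reachable : ∀ i x y, s x y → (F i ⊓ classGraph s).Reachable x y
  covered : ∀ x y, G.Adj x y → ¬ s x y → ∃ i, (F i).Adj x y

theorem IsParetoMaximal.exists_isTight [Finite V] (hmax : IsParetoMaximal G F)
    (hF : IsForestPacking G F) : ∃ s : Setoid V, IsTight G F s := by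
  -- The classes are the components of the exchange graph. An edge uncovered by `F` itself belongs
  -- to that graph, so it cannot cross.
  refine ⟨(exchangeGraph G F).reachableSetoid, fun i x y hxy ↦ ?_, fun x y hG hxy ↦ ?_⟩
  · have h1 : (F i ⊓ exchangeGraph G F).Reachable x y := by
      refine Reachable.lift (fun a b hab ↦ ?_) (H := exchangeGraph G F) hxy
      obtain ⟨F', h, hG, hu⟩ := hab
      refine h.reachable_of_reachable hF i ?_
      obtain ⟨p, hp⟩ := (hmax.reachable hF h hG hu i).exists_isPath
      exact h.reachable_inf_exchangeGraph hF hG hu i ⟨p, hp⟩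
    refine h1.mono (inf_le_inf_left _ fun a b hab ↦ ⟨hab.ne, hab.reachable⟩)
  · by_contra! h
    exact hxy (Adj.reachable ⟨F, .refl, hG, h⟩)

end

/-- The edges of a tight family, counted along the classes. -/
theorem IsTight.sum_ncard_edgeSet [Finite V] [Fintype ι] {G : SimpleGraph V}
    {F : ι → SimpleGraph V} {s : Setoid V} (hs : IsTight G F s) (hF : IsForestPacking G F) :
    ∑ i, (F i).edgeSet.ncard + Fintype.card ι * Nat.card (Quotient s) =
      (G \ classGraph s).edgeSet.ncard + Fintype.card ι * Nat.card V := by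
  have h1 : ∀ i, (F i).edgeSet.ncard =
      (F i ⊓ classGraph s).edgeSet.ncard + (F i \ classGraph s).edgeSet.ncard := by
    intro i
    rw [edgeSet_inf, edgeSet_sdiff, Set.ncard_inter_add_ncard_sdiff_eq_ncard]
  -- Tightness makes the components of `F i ⊓ classGraph s` exactly the classes of `s`.
  have h2 : ∀ i, (F i ⊓ classGraph s).edgeSet.ncard + Nat.card (Quotient s) = Nat.card V := by
    intro i
    rw [← ((hF.isAcyclic i).anti inf_le_left).ncard_edgeSet_add_card_connectedComponent]
    congr 1
    refine Nat.card_congr (Quotient.congrRight (r := s)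
      (r' := (F i ⊓ classGraph s).reachableSetoid) fun x y ↦ ⟨hs.reachable i x y, fun h ↦ ?_⟩)
    exact Reachable.of_forall_adj (H := F i ⊓ classGraph s) s.iseqv (fun a b hab ↦ hab.2.2) h
  have h3 : (G \ classGraph s).edgeSet = ⋃ i, (F i \ classGraph s).edgeSet := by
    ext e
    induction e with
    | h x y =>
      simp only [mem_edgeSet, Set.mem_iUnion, sdiff_adj]
      refine ⟨fun ⟨h, h'⟩ ↦ ?_, fun ⟨i, h, h'⟩ ↦ ⟨hF.le i h, h'⟩⟩
      obtain ⟨i, hi⟩ := hs.covered x y h fun hxy ↦ h' ⟨h.ne, hxy⟩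
      exact ⟨i, hi, h'⟩
  have h4 : (G \ classGraph s).edgeSet.ncard = ∑ i, (F i \ classGraph s).edgeSet.ncard := by
    rw [h3, Set.ncard_iUnion_of_finite (fun i ↦ Set.toFinite _), finsum_eq_sum_of_fintype]
    intro i j hij
    rw [Function.onFun, disjoint_edgeSet, disjoint_left]
    exact fun x y hx hy ↦ hF.disjoint hij hx.1 hy.1
  calc _ = ∑ i, ((F i ⊓ classGraph s).edgeSet.ncard + Nat.card (Quotient s)
        + (F i \ classGraph s).edgeSet.ncard) := by
        simp only [h1, Finset.sum_add_distrib, Finset.sum_const, Finset.card_univ, smul_eq_mul]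
        ring
    _ = _ := by
        simp only [h2, h4, Finset.sum_add_distrib, Finset.sum_const, Finset.card_univ, smul_eq_mul]
        ring

end SimpleGraph

/-! ### Spanning tree packings with an additional forest. -/

namespace SimpleGraph

variable {V : Type*} {G : SimpleGraph V} {k d : ℕ}

theorem IsForestPacking.bot {ι : Type*} : IsForestPacking G fun _ : ι ↦ ⊥ :=
  ⟨fun _ ↦ bot_le, fun _ ↦ isAcyclic_bot, fun _ _ _ _ _ h ↦ h.elim⟩

variable [Finite V]

theorem IsAcyclic.ncard_edgeSet_add_one_le [Nonempty V] {T : SimpleGraph V} (hT : T.IsAcyclic) :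
    T.edgeSet.ncard + 1 ≤ Nat.card V := by
  have h1 := hT.ncard_edgeSet_add_card_connectedComponent
  have : Nonempty T.ConnectedComponent := ‹Nonempty V›.map T.connectedComponentMk
  have h2 : 0 < Nat.card T.ConnectedComponent := Nat.card_pos
  omega

/-- The theorem of Nash-Williams and Tutte on edge-disjoint spanning trees. -/
theorem exists_isTree_packing [Nonempty V]
    (h : ∀ s : Setoid V, k * Nat.card (Quotient s) ≤ (G \ classGraph s).edgeSet.ncard + k) :
    ∃ T : Fin k → SimpleGraph V, IsForestPacking G T ∧ ∀ i, (T i).IsTree := by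
  obtain ⟨T, hT, hmax⟩ := Set.exists_max_image {T : Fin k → SimpleGraph V | IsForestPacking G T}
    (fun T ↦ ∑ i, (T i).edgeSet.ncard) (Set.toFinite _) ⟨_, IsForestPacking.bot⟩
  have hpareto : IsParetoMaximal G T := by
    intro T' hT' hle i
    by_contra! hlt
    exact (hmax T' hT').not_gt (Finset.sum_lt_sum (fun i _ ↦ hle i) ⟨i, Finset.mem_univ _, hlt⟩)
  obtain ⟨s, hs⟩ := hpareto.exists_isTight hT
  have hsum := hs.sum_ncard_edgeSet hT
  rw [Fintype.card_fin] at hsum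
  have hle : ∀ i, (T i).edgeSet.ncard + 1 ≤ Nat.card V :=
    fun i ↦ (hT.isAcyclic i).ncard_edgeSet_add_one_le
  -- The tight count and the hypothesis for `s` give at least k(n-1) edges in total, so every forest
  -- attains its maximum n-1.
  have h1 : ∑ i, ((T i).edgeSet.ncard + 1) = ∑ _i : Fin k, Nat.card V := by
    refine le_antisymm (Finset.sum_le_sum fun i _ ↦ hle i) ?_
    have := h s
    simp only [Finset.sum_add_distrib, Finset.sum_const, Finset.card_univ, Fintype.card_fin,
      smul_eq_mul]
    omega
  rw [Finset.sum_eq_sum_iff_of_le fun i _ ↦ hle i] at h1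
  exact ⟨T, hT, fun i ↦ (hT.isAcyclic i).isTree_of_card_le (h1 i (Finset.mem_univ _)).ge⟩

/-- `k` spanning trees `F (some i)` and a further forest `F none`, pairwise edge-disjoint. -/
structure IsTreesAndForest (G : SimpleGraph V) (F : Option (Fin k) → SimpleGraph V) : Prop
    extends IsForestPacking G F where
  isTree : ∀ i, (F (some i)).IsTree

/-- If a tree of the packing is disconnected on a component of the forest, an exchange yields a
forest of the same size with a smaller component. -/
theorem IsTreesAndForest.exists_smaller {F : Option (Fin k) → SimpleGraph V}
    (hF : IsTreesAndForest G F) {v x₀ y₀ : V} {s : Setoid V}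
    (hs : ∀ a b, (F none).Reachable v a → (s a b ↔ (F none).Reachable v b)) (i : Option (Fin k))
    (hx₀ : (F none).Reachable v x₀) (hy₀ : (F none).Reachable v y₀)
    (hnot : ¬ (F i ⊓ classGraph s).Reachable x₀ y₀) :
    ∃ F' : Option (Fin k) → SimpleGraph V, ∃ v', IsTreesAndForest G F' ∧
      (F' none).edgeSet.ncard = (F none).edgeSet.ncard ∧
      {w | (F' none).Reachable v' w}.ncard < {w | (F none).Reachable v w}.ncard := by
  -- Some forest edge `s(a, b)` of the component has ends not joined in `F i` within a class. Since
  -- the forest contains that edge, `i` must be a tree.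
  obtain ⟨a, b, hab, hva, hnab⟩ : ∃ a b, (F none).Adj a b ∧ (F none).Reachable v a ∧
      ¬ (F i ⊓ (classGraph s)).Reachable a b := by
    by_contra! hcon
    refine hnot ?_
    obtain ⟨p⟩ := hx₀.symm.trans hy₀
    clear hnot
    induction p with
    | nil => exact Reachable.refl _
    | cons hadj _ ih => exact (hcon _ _ hadj hx₀).trans (ih (hx₀.trans hadj.reachable) hy₀)
  have hvb : (F none).Reachable v b := hva.trans hab.reachable
  obtain ⟨j, rfl⟩ : ∃ j, i = some j := by
    cases i with
    | none =>
      have : (F none ⊓ classGraph s).Adj a b := ⟨hab, hab.ne, (hs a b hva).2 hvb⟩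
      exact absurd this.reachable hnab
    | some j => exact ⟨j, rfl⟩
  obtain ⟨P, hP⟩ := ((hF.isTree j).connected.preconnected a b).exists_isPath
  -- The tree path from `a` to `b` has to leave the component of `v`; let `s(x, y)` be an edge where
  -- it does. The tree and the forest then swap `s(x, y)` and `s(a, b)`.
  obtain ⟨e, heP, he1, he2⟩ := P.exists_boundary_dart
    {w | (F (some j) ⊓ classGraph s).Reachable a w} (Reachable.refl _) hnab
  obtain ⟨⟨x, y⟩, hxy⟩ := e
  simp only [Set.mem_ofPred_eq] at he1 he2
  replace hxy : (F (some j)).Adj x y := hxy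
  have heP' : s(x, y) ∈ P.edges := List.mem_map.2 ⟨_, heP, rfl⟩
  have hsax : s a x :=
    Reachable.of_forall_adj (H := F (some j) ⊓ classGraph s) s.iseqv (fun _ _ h ↦ h.2.2) he1
  have hvx : (F none).Reachable v x := (hs a x hva).1 hsax
  have hvy : ¬ (F none).Reachable v y := fun hvy ↦
    he2 (he1.trans (Adj.reachable (G := F (some j) ⊓ classGraph s)
      ⟨hxy, hxy.ne, (hs x y hvx).2 hvy⟩))
  have hnxy : ¬ ((F none).deleteEdges {s(a, b)}).Reachable x y := fun h ↦
    hvy (hvx.trans (h.mono (deleteEdges_le _)))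
  have hnone : ∀ l, l ≠ none → ∀ p q, ((F none).exchange s(a, b) x y).Adj p q →
      (F l).Adj p q → l = some j ∧ s(p, q) = s(x, y) := by
    intro l hl p q h h'
    rw [exchange_adj hxy.ne] at h
    rcases h with h | h
    · exact absurd h' (hF.disjoint hl.symm h.1)
    · refine ⟨?_, h⟩
      by_contra hlj
      exact hF.disjoint hlj h' (((F (some j)).adj_congr_of_sym2 h).2 hxy)
  have hsome : ∀ l, l ≠ some j → ∀ p q, ((F (some j)).exchange s(x, y) a b).Adj p q →
      (F l).Adj p q → l = none ∧ s(p, q) = s(a, b) := by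
    intro l hl p q h h'
    rw [exchange_adj hab.ne] at h
    rcases h with h | h
    · exact absurd h' (hF.disjoint hl.symm h.1)
    · refine ⟨?_, h⟩
      by_contra hln
      exact hF.disjoint hln h' (((F none).adj_congr_of_sym2 h).2 hab)
  have hboth : ∀ p q, ((F none).exchange s(a, b) x y).Adj p q →
      ¬ ((F (some j)).exchange s(x, y) a b).Adj p q := by
    intro p q h h'
    rw [exchange_adj hxy.ne] at h
    rw [exchange_adj hab.ne] at h'
    rcases h with h | h <;> rcases h' with h' | h'
    · exact hF.disjoint (by simp) h.1 h'.1
    · exact h.2 h'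
    · exact h'.2 h
    · exact hF.disjoint (by simp) hab (((F (some j)).adj_congr_of_sym2 (h'.symm.trans h)).2 hxy)
  have hT : ((F (some j)).exchange s(x, y) a b).IsAcyclic :=
    (hF.isAcyclic _).exchange ((hF.isAcyclic _).not_reachable_deleteEdges ⟨P, hP⟩ heP')
  have hnadj : ¬ (F (some j)).Adj a b := hF.disjoint (by simp) hab
  set F' : Option (Fin k) → SimpleGraph V := fun l ↦
    if l = none then (F none).exchange s(a, b) x y
    else if l = some j then (F (some j)).exchange s(x, y) a b else F l with hF'
  have h0 : F' none = (F none).exchange s(a, b) x y := if_pos rfl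
  have hj : F' (some j) = (F (some j)).exchange s(x, y) a b := by simp [hF']
  have hl : ∀ l, l ≠ none → l ≠ some j → F' l = F l := fun l h h' ↦ by simp [hF', h, h']
  have hcases : ∀ l : Option (Fin k), l = none ∨ l = some j ∨ l ≠ none ∧ l ≠ some j := by
    intro l
    tauto
  have hpack : IsForestPacking G F' := by
    refine ⟨fun l ↦ ?_, fun l ↦ ?_, fun l m hlm p q hp hq ↦ ?_⟩
    · rcases hcases l with rfl | rfl | ⟨h1, h2⟩
      · rw [h0]
        exact sup_le ((deleteEdges_le _).trans (hF.le _))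
          ((edge_le_iff _).2 (.inr (hF.le _ hxy)))
      · rw [hj]
        exact sup_le ((deleteEdges_le _).trans (hF.le _))
          ((edge_le_iff _).2 (.inr (hF.le _ hab)))
      · rw [hl l h1 h2]
        exact hF.le l
    · rcases hcases l with rfl | rfl | ⟨h1, h2⟩
      · rw [h0]
        exact (hF.isAcyclic _).exchange hnxy
      · rwa [hj]
      · rw [hl l h1 h2]
        exact hF.isAcyclic l
    · rcases hcases l with rfl | rfl | ⟨h1, h2⟩ <;> rcases hcases m with rfl | rfl | ⟨h3, h4⟩
      · exact hlm rfl
      · rw [h0] at hp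
        rw [hj] at hq
        exact hboth p q hp hq
      · rw [h0] at hp
        rw [hl m h3 h4] at hq
        exact h4 (hnone m h3 p q hp hq).1
      · rw [h0] at hq
        rw [hj] at hp
        exact hboth p q hq hp
      · exact hlm rfl
      · rw [hj] at hp
        rw [hl m h3 h4] at hq
        exact h3 (hsome m h4 p q hp hq).1
      · rw [h0] at hq
        rw [hl l h1 h2] at hp
        exact h2 (hnone l h1 p q hq hp).1
      · rw [hj] at hq
        rw [hl l h1 h2] at hp
        exact h1 (hsome l h2 p q hq hp).1
      · rw [hl l h1 h2] at hp
        rw [hl m h3 h4] at hq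
        exact hF.disjoint hlm hp hq
  have hbridge : ¬ ((F none).deleteEdges {s(a, b)}).Reachable a b :=
    isAcyclic_iff_forall_adj_isBridge.1 (hF.isAcyclic none) hab
  -- Removing the bridge `s(a, b)` splits the component. The new edge `s(x, y)` attaches to the part
  -- containing `x`; `v'` is taken in the other part, which remains a component and is smaller.
  obtain ⟨v', hvv', hv'x⟩ : ∃ v', (F none).Reachable v v' ∧
      ¬ ((F none).deleteEdges {s(a, b)}).Reachable v' x := by
    by_contra! h
    exact hbridge ((h a hva).trans (h b hvb).symm)
  have hv'y : ¬ ((F none).deleteEdges {s(a, b)}).Reachable v' y := fun h ↦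
    hvy (hvv'.trans (h.mono (deleteEdges_le _)))
  have hcomp : ∀ w, (F' none).Reachable v' w →
      ((F none).deleteEdges {s(a, b)}).Reachable v' w := by
    intro w hw
    rw [h0] at hw
    refine (hw.of_forall_adj (r := fun p q ↦
      (((F none).deleteEdges {s(a, b)}).Reachable v' p ↔
        ((F none).deleteEdges {s(a, b)}).Reachable v' q))
      ⟨fun _ ↦ Iff.rfl, fun h ↦ h.symm, fun h h' ↦ h.trans h'⟩ fun p q hpq ↦ ?_).1 (.refl _)
    rw [SimpleGraph.exchange, sup_adj, edge_adj] at hpq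
    rcases hpq with hpq | ⟨⟨rfl, rfl⟩ | ⟨rfl, rfl⟩, _⟩
    · exact ⟨fun h ↦ h.trans hpq.reachable, fun h ↦ h.trans hpq.symm.reachable⟩
    · exact iff_of_false hv'x hv'y
    · exact iff_of_false hv'y hv'x
  have : Nonempty V := ⟨v⟩
  refine ⟨F', v', ⟨hpack, fun l ↦ ?_⟩, ?_, ?_⟩
  · rcases eq_or_ne l j with rfl | hlj
    · rw [hj]
      refine hT.isTree_of_card_le ?_
      rw [ncard_edgeSet_exchange hxy hab.ne hnadj, (hF.isTree l).ncard_edgeSet_add_one]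
    · rw [hl _ (by simp) (by simpa using hlj)]
      exact hF.isTree l
  · rw [h0, ncard_edgeSet_exchange hab hxy.ne fun h ↦ hvy (hvx.trans h.reachable)]
  · refine Set.ncard_lt_ncard (Set.ssubset_iff_exists.2 ⟨fun w hw ↦ ?_, x, hvx, fun hx ↦ ?_⟩)
    · exact hvv'.trans ((hcomp w hw).mono (deleteEdges_le _))
    · exact hv'x (hcomp x hx)

/-- The setoid whose classes are the component of `v` in `H` and the remaining classes of `s`. -/
def joinComponent (s : Setoid V) (H : SimpleGraph V) (v : V)
    (hs : ∀ x y, s x y → H.Reachable x y) : Setoid V where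
  r x y := s x y ∨ H.Reachable v x ∧ H.Reachable v y
  iseqv :=
    { refl := fun x ↦ .inl (s.refl x)
      symm := fun h ↦ h.imp s.symm And.symm
      trans := by
        rintro x y z (h | h) (h' | h')
        · exact .inl (s.trans h h')
        · exact .inr ⟨h'.1.trans (hs x y h).symm, h'.2⟩
        · exact .inr ⟨h.1, h.2.trans (hs y z h')⟩
        · exact .inr ⟨h.1, h'.2⟩ }

/-- If one component of a graph is a single class and every other one contains at most `d` classes,
then the number of classes is bounded in terms of the number of components. -/
theorem card_quotient_le {s : Setoid V} {H : SimpleGraph V} {v : V}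
    (hs : ∀ x y, s x y → H.Reachable x y)
    (hv : ∀ x y, H.Reachable v x → H.Reachable v y → s x y)
    (hd : ∀ c : H.ConnectedComponent, Nat.card c ≤ d) :
    Nat.card (Quotient s) + d ≤ 1 + d * Nat.card H.ConnectedComponent := by
  classical
  have := Fintype.ofFinite V
  have := Fintype.ofFinite (Quotient s)
  have := Fintype.ofFinite H.ConnectedComponent
  let f : Quotient s → H.ConnectedComponent :=
    Quotient.lift H.connectedComponentMk fun x y h ↦ ConnectedComponent.sound (hs x y h)
  have hfib : ∀ c, (Finset.univ.filter fun q ↦ f q = c).card ≤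
      if c = H.connectedComponentMk v then 1 else d := by
    intro c
    split_ifs with hc
    · rw [Finset.card_le_one]
      intro p hp q hq
      induction p using Quotient.inductionOn with | h x => ?_
      induction q using Quotient.inductionOn with | h y => ?_
      simp only [Finset.mem_filter_univ] at hp hq
      subst hc
      exact Quotient.sound (hv x y (ConnectedComponent.exact hp).symm
        (ConnectedComponent.exact hq).symm)
    · refine le_trans ?_ (hd c)
      rw [← Fintype.card_subtype, ← Nat.card_eq_fintype_card]
      refine Nat.card_le_card_of_surjective
        (fun x : c ↦ (⟨Quotient.mk s x.1, x.2⟩ : {q // f q = c})) ?_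
      rintro ⟨q, hq⟩
      induction q using Quotient.inductionOn with | h x => ?_
      exact ⟨⟨x, hq⟩, rfl⟩
  have hsum : Fintype.card (Quotient s) ≤
      ∑ c : H.ConnectedComponent, if c = H.connectedComponentMk v then 1 else d := by
    rw [← Finset.card_univ, Finset.card_eq_sum_card_fiberwise (f := f) (t := Finset.univ)
      (fun _ _ ↦ Finset.mem_coe.2 (Finset.mem_univ _))]
    exact Finset.sum_le_sum fun c _ ↦ hfib c
  have hsum' : (∑ c : H.ConnectedComponent, if c = H.connectedComponentMk v then 1 else d) + d =
      1 + d * Fintype.card H.ConnectedComponent := by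
    rw [← Finset.add_sum_erase _ _ (Finset.mem_univ (H.connectedComponentMk v)), if_pos rfl,
      Finset.sum_congr rfl fun c hc ↦ if_neg (Finset.ne_of_mem_erase hc), Finset.sum_const,
      smul_eq_mul, Finset.card_erase_of_mem (Finset.mem_univ _), Finset.card_univ]
    have : 0 < Fintype.card H.ConnectedComponent :=
      Fintype.card_pos_iff.2 ⟨H.connectedComponentMk v⟩
    obtain ⟨m, hm⟩ := Nat.exists_eq_add_of_lt this
    rw [hm]
    simp only [zero_add, Nat.add_sub_cancel]
    ring
  rw [Nat.card_eq_fintype_card, Nat.card_eq_fintype_card]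
  omega

end SimpleGraph

/-! ### The extremal choice and the partition theorem. -/

namespace SimpleGraph

variable {V : Type*} [Finite V] {G : SimpleGraph V} {k d : ℕ}

theorem exists_isTreesAndForest_max [Nonempty V]
    (h : ∀ s : Setoid V, k * Nat.card (Quotient s) ≤ (G \ classGraph s).edgeSet.ncard + k) :
    ∃ (F : Option (Fin k) → SimpleGraph V) (v : V), IsTreesAndForest G F ∧
      (∀ F' : Option (Fin k) → SimpleGraph V, IsTreesAndForest G F' →
        (F' none).edgeSet.ncard ≤ (F none).edgeSet.ncard) ∧
      ∀ (F' : Option (Fin k) → SimpleGraph V) (v' : V), IsTreesAndForest G F' →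
        (F' none).edgeSet.ncard = (F none).edgeSet.ncard →
        {w | (F none).Reachable v w}.ncard ≤ {w | (F' none).Reachable v' w}.ncard := by
  obtain ⟨T, hT, hTtree⟩ := exists_isTree_packing h
  let F₀ : Option (Fin k) → SimpleGraph V := fun l ↦ l.elim ⊥ T
  have hF₀ : IsTreesAndForest G F₀ := by
    refine ⟨⟨fun l ↦ ?_, fun l ↦ ?_, fun l m hlm x y hl hm ↦ ?_⟩, hTtree⟩
    · cases l with
      | none => exact bot_le
      | some i => exact hT.le i
    · cases l with
      | none => exact isAcyclic_bot
      | some i => exact hT.isAcyclic i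
    · cases l with
      | none => exact hl
      | some i =>
        cases m with
        | none => exact hm
        | some j => exact hT.disjoint (fun hij ↦ hlm (congrArg some hij)) hl hm
  obtain ⟨F₁, hF₁, hmax⟩ := Set.exists_max_image
    {F : Option (Fin k) → SimpleGraph V | IsTreesAndForest G F}
    (fun F ↦ (F none).edgeSet.ncard) (Set.toFinite _) ⟨F₀, hF₀⟩
  obtain ⟨⟨F, v⟩, ⟨hF, hFF₁⟩, hmin⟩ := Set.exists_min_image
    {q : (Option (Fin k) → SimpleGraph V) × V | IsTreesAndForest G q.1 ∧
      (q.1 none).edgeSet.ncard = (F₁ none).edgeSet.ncard}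
    (fun q ↦ {w | (q.1 none).Reachable q.2 w}.ncard) (Set.toFinite _)
    ⟨(F₁, Classical.arbitrary V), hF₁, rfl⟩
  replace hFF₁ : (F none).edgeSet.ncard = (F₁ none).edgeSet.ncard := hFF₁
  exact ⟨F, v, hF, fun F' hF' ↦ hFF₁ ▸ hmax F' hF',
    fun F' v' hF' h' ↦ hmin (F', v') ⟨hF', h'.trans hFF₁⟩⟩

/-- Spanning trees already have maximal size, so a packing that dominates `F` again consists of k
spanning trees and a forest. -/
theorem IsTreesAndForest.isParetoMaximal [Nonempty V] {F : Option (Fin k) → SimpleGraph V}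
    (hF : IsTreesAndForest G F)
    (hmax : ∀ F' : Option (Fin k) → SimpleGraph V, IsTreesAndForest G F' →
        (F' none).edgeSet.ncard ≤ (F none).edgeSet.ncard) : IsParetoMaximal G F := by
  intro F' hF' hle i
  have htree : ∀ j, (F (some j)).edgeSet.ncard + 1 = Nat.card V :=
    fun j ↦ (hF.isTree j).ncard_edgeSet_add_one
  cases i with
  | none =>
    refine hmax F' ⟨hF', fun j ↦ (hF'.isAcyclic _).isTree_of_card_le ?_⟩
    rw [← htree j]
    exact Nat.succ_le_succ (hle _)
  | some j =>
    have := (hF'.isAcyclic (some j)).ncard_edgeSet_add_one_le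
    have := htree j
    omega

theorem IsTreesAndForest.card_eq [Nonempty V] {F : Option (Fin k) → SimpleGraph V}
    (hF : IsTreesAndForest G F) {s : Setoid V} (hs : IsTight G F s) :
    (F none).edgeSet.ncard + (k + 1) * Nat.card (Quotient s) =
      (G \ classGraph s).edgeSet.ncard + k + Nat.card V := by
  have h1 := hs.sum_ncard_edgeSet hF.toIsForestPacking
  have h2 : ∑ i, ((F (some i)).edgeSet.ncard + 1) = k * Nat.card V := by
    simp [(hF.isTree _).ncard_edgeSet_add_one]
  rw [Fintype.sum_option, Fintype.card_option, Fintype.card_fin] at h1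
  rw [Finset.sum_add_distrib, Finset.sum_const, Finset.card_univ, Fintype.card_fin,
    smul_eq_mul] at h2
  linarith

end SimpleGraph

open SimpleGraph in
/-- A strengthening of the theorem of Nash-Williams and Tutte: the partition condition with
`k + (d - 1) / d` in place of `k` yields `k` spanning trees together with a large forest. -/
theorem propertyP_of_forall_setoid {V : Type*} [Fintype V] {G : SimpleGraph V} {k d : ℕ}
    (hd : 1 ≤ d) (hV : 2 ≤ Fintype.card V)
    (h : ∀ s : Setoid V, 2 ≤ Nat.card (Quotient s) →
      ((k : ℝ) + ((d : ℝ) - 1) / d) * ((Nat.card (Quotient s) : ℝ) - 1) <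
        (G \ classGraph s).edgeSet.ncard) : PropertyP G k d := by
  have : Nonempty V := Fintype.card_pos_iff.1 (by omega)
  have hd0 : (0 : ℝ) < d := by exact_mod_cast hd
  obtain ⟨r, hr⟩ : ∃ r : ℝ, ((d : ℝ) - 1) / d = r := ⟨_, rfl⟩
  have hr0 : 0 ≤ r := hr ▸ div_nonneg (sub_nonneg.2 (by exact_mod_cast hd)) hd0.le
  have hr1 : r < 1 := by rw [← hr, div_lt_one hd0]; linarith
  rw [hr] at h
  have hpos : ∀ s : Setoid V, 0 < Nat.card (Quotient s) := fun s ↦ by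
    have : Nonempty (Quotient s) := ‹Nonempty V›.map (Quotient.mk s)
    exact Nat.card_pos
  obtain ⟨F, v, hF, hmax, hmin⟩ := exists_isTreesAndForest_max (G := G) (k := k) fun s ↦ by
    rcases Nat.lt_or_ge (Nat.card (Quotient s)) 2 with h2 | h2
    · have : Nat.card (Quotient s) = 1 := by have := hpos s; omega
      rw [this]
      omega
    · have h3 := h s h2
      have h4 : (2 : ℝ) ≤ Nat.card (Quotient s) := by exact_mod_cast h2
      have h5 : (k : ℝ) * Nat.card (Quotient s) ≤ (G \ classGraph s).edgeSet.ncard + k := by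
        nlinarith
      exact_mod_cast h5
  obtain ⟨s, hs⟩ := (hF.isParetoMaximal hmax).exists_isTight hF.toIsForestPacking
  -- With p ≥ 2 classes, the tight count gives |E(F)| > n - r - (1-r)p ≥ r(n-1), using p ≤ n. With p
  -- = 1 it gives |E(F)| ≥ n-1.
  have hcard : r * ((Fintype.card V : ℝ) - 1) < (F none).edgeSet.ncard := by
    have h1 : ((F none).edgeSet.ncard : ℝ) + (k + 1) * Nat.card (Quotient s) =
      (G \ classGraph s).edgeSet.ncard + k + Nat.card V := by exact_mod_cast hF.card_eq hs
    have h2 : (Nat.card (Quotient s) : ℝ) ≤ Nat.card V := by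
      exact_mod_cast Nat.card_le_card_of_surjective _ (Quotient.mk_surjective (s := s))
    have h3 : (2 : ℝ) ≤ Nat.card V := by
      rw [Nat.card_eq_fintype_card]
      exact_mod_cast hV
    rw [← Nat.card_eq_fintype_card]
    rcases Nat.lt_or_ge (Nat.card (Quotient s)) 2 with h4 | h4
    · have : Nat.card (Quotient s) = 1 := by have := hpos s; omega
      rw [this] at h1
      have h5 : (0 : ℝ) ≤ (G \ classGraph s).edgeSet.ncard := Nat.cast_nonneg _
      push_cast at h1
      nlinarith
    · have := h s h4
      nlinarith
  refine ⟨fun i ↦ F (some i), F none, fun i ↦ ⟨hF.le _, hF.isTree i⟩, fun i j hij ↦ ?_, hF.le _,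
    hF.isAcyclic _, fun i ↦ ?_, hr ▸ hcard, fun hnt ↦ ?_⟩
  · rw [disjoint_edgeSet, SimpleGraph.disjoint_left]
    exact hF.disjoint (by simpa using hij)
  · rw [disjoint_edgeSet, SimpleGraph.disjoint_left]
    exact hF.disjoint (by simp)
  have hsle : ∀ x y, s x y → (F none).Reachable x y :=
    fun x y hxy ↦ (hs.reachable none x y hxy).mono inf_le_left
  let t := joinComponent s (F none) v hsle
  have htle : ∀ x y, t x y → (F none).Reachable x y := fun x y hxy ↦
    hxy.elim (hsle x y) fun h ↦ h.1.symm.trans h.2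
  -- Failure of connectivity on the merged component would allow an exchange producing a smaller
  -- component, against the minimal choice of `v`.
  have ht : IsTight G F t := by
    refine ⟨fun i x y hxy ↦ ?_, fun x y hG hxy ↦ hs.covered x y hG fun h ↦ hxy (.inl h)⟩
    rcases hxy with hxy | hxy
    · refine (hs.reachable i x y hxy).mono (inf_le_inf_left _ ?_)
      exact fun a b hab ↦ ⟨hab.1, .inl hab.2⟩
    · by_contra hnot
      obtain ⟨F', v', hF', hcard', hlt⟩ := hF.exists_smaller (s := t)
        (fun a b ha ↦ ⟨fun hab ↦ ha.trans (htle a b hab), fun hb ↦ .inr ⟨ha, hb⟩⟩) i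
        hxy.1 hxy.2 hnot
      exact (hmin F' v' hF' hcard').not_gt hlt
  have ht2 : 2 ≤ Nat.card (Quotient t) := by
    by_contra hcon
    have h1 : Nat.card (Quotient t) ≤ 1 := by omega
    have h2 := Finite.card_le_one_iff_subsingleton.1 h1
    exact hnt ⟨⟨fun x y ↦ htle x y (Quotient.exact (Subsingleton.elim (Quotient.mk t x)
      (Quotient.mk t y)))⟩, hF.isAcyclic _⟩
  -- Otherwise each component has at most d vertices, so p + d ≤ 1 + dω for p classes of `t` and ω
  -- components. The tight count and the crossing hypothesis give p - ω > r(p-1); multiplied by d,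
  -- this is the reverse strict inequality.
  by_contra! hcon
  have hsize : ∀ c : (F none).ConnectedComponent, Nat.card c ≤ d := by
    intro c
    have := hcon c
    have := ((hF.isAcyclic none).isTree_connectedComponent c).ncard_edgeSet_add_one
    omega
  have h1 : (Nat.card (Quotient t) : ℝ) + d ≤ 1 + d * Nat.card (F none).ConnectedComponent := by
    exact_mod_cast card_quotient_le htle (fun x y hx hy ↦ .inr ⟨hx, hy⟩) hsize
  have h2 : ((F none).edgeSet.ncard : ℝ) + Nat.card (F none).ConnectedComponent = Nat.card V := by
    exact_mod_cast (hF.isAcyclic none).ncard_edgeSet_add_card_connectedComponent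
  have h3 : ((F none).edgeSet.ncard : ℝ) + (k + 1) * Nat.card (Quotient t) =
      (G \ classGraph t).edgeSet.ncard + k + Nat.card V := by exact_mod_cast hF.card_eq ht
  have h4 := h t ht2
  have h5 : d * r = d - 1 := by rw [← hr]; field_simp
  have h6 : r * ((Nat.card (Quotient t) : ℝ) - 1) <
      Nat.card (Quotient t) - Nat.card (F none).ConnectedComponent := by linarith
  have h7 := mul_lt_mul_of_pos_left h6 hd0
  rw [← mul_assoc, h5] at h7
  linarith

/-! ### Rayleigh quotients on two-dimensional spaces. -/

open Matrix in
theorem Matrix.IsHermitian.dotProduct_mulVec_eq_sum {V : Type*} [Fintype V] [DecidableEq V]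
    {M : Matrix V V ℝ} (hM : M.IsHermitian) (f : V → ℝ) :
    f ⬝ᵥ M *ᵥ f = ∑ i, hM.eigenvalues i * (hM.eigenvectorBasis i ⬝ᵥ f) ^ 2 := by
  have h := hM.eigenvectorBasis.sum_inner_mul_inner (WithLp.toLp 2 f) (WithLp.toLp 2 (M *ᵥ f))
  simp only [EuclideanSpace.inner_eq_star_dotProduct, star_trivial] at h
  rw [dotProduct_comm, ← h]
  refine Finset.sum_congr rfl fun i _ ↦ ?_
  rw [dotProduct_comm (M *ᵥ f), dotProduct_mulVec, ← mulVec_transpose,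
    ← conjTranspose_eq_transpose_of_trivial, hM.eq, hM.mulVec_eigenvectorBasis, smul_dotProduct,
    smul_eq_mul]
  ring

open Matrix in
theorem Matrix.IsHermitian.dotProduct_self_eq_sum {V : Type*} [Fintype V] [DecidableEq V]
    {M : Matrix V V ℝ} (hM : M.IsHermitian) (f : V → ℝ) :
    f ⬝ᵥ f = ∑ i, (hM.eigenvectorBasis i ⬝ᵥ f) ^ 2 := by
  have h := hM.eigenvectorBasis.sum_inner_mul_inner (WithLp.toLp 2 f) (WithLp.toLp 2 f)
  simp only [EuclideanSpace.inner_eq_star_dotProduct, star_trivial] at h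
  rw [← h]
  refine Finset.sum_congr rfl fun i _ ↦ ?_
  rw [dotProduct_comm f]
  ring

theorem exists_combination_eq_zero (c d : ℝ) :
    ∃ x y : ℝ, (x ≠ 0 ∨ y ≠ 0) ∧ x * c + y * d = 0 := by
  by_cases hd : d = 0
  · exact ⟨0, 1, .inr one_ne_zero, by simp [hd]⟩
  · exact ⟨d, -c, .inl hd, by ring⟩

section

open Matrix

variable {V : Type*} [Fintype V] [DecidableEq V] {M : Matrix V V ℝ} (hM : M.IsHermitian)

/-- Every two-dimensional space contains a vector whose Rayleigh quotient is at most the second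
largest eigenvalue. -/
theorem exists_rayleigh_le_second (hV : 2 ≤ Fintype.card V) (g h : V → ℝ) :
    ∃ x y : ℝ, (x ≠ 0 ∨ y ≠ 0) ∧ (x • g + y • h) ⬝ᵥ M *ᵥ (x • g + y • h) ≤
      nthLargestEigenvalue hM 2 * ((x • g + y • h) ⬝ᵥ (x • g + y • h)) := by
  -- This is the enumeration by which `eigenvalues` is defined from `eigenvalues₀`, so `i₀` indexes
  -- the largest eigenvalue. The combination is chosen orthogonal to its eigenvector.
  let e : Fin (Fintype.card V) ≃ V := Fintype.equivOfCardEq (Fintype.card_fin _)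
  let i₀ : V := e ⟨0, by omega⟩
  obtain ⟨x, y, hxy, h0⟩ := exists_combination_eq_zero (hM.eigenvectorBasis i₀ ⬝ᵥ g)
    (hM.eigenvectorBasis i₀ ⬝ᵥ h)
  refine ⟨x, y, hxy, ?_⟩
  rw [hM.dotProduct_mulVec_eq_sum, hM.dotProduct_self_eq_sum, Finset.mul_sum]
  refine Finset.sum_le_sum fun i _ ↦ ?_
  by_cases hi : i = i₀
  · have : hM.eigenvectorBasis i ⬝ᵥ (x • g + y • h) = 0 := by
      rw [hi, dotProduct_add, dotProduct_smul, dotProduct_smul]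
      exact h0
    rw [this]
    simp
  · refine mul_le_mul_of_nonneg_right ?_ (sq_nonneg _)
    rw [nthLargestEigenvalue, dif_pos ⟨by norm_num, hV⟩]
    refine hM.eigenvalues₀_antitone (Fin.le_def.2 ?_)
    have h1 : e.symm i ≠ ⟨0, by omega⟩ := fun h ↦ hi (e.symm_apply_eq.1 h)
    have h2 : (e.symm i).1 ≠ 0 := fun h ↦ h1 (Fin.ext h)
    exact Nat.one_le_iff_ne_zero.2 h2

/-- Every two-dimensional space contains a vector whose Rayleigh quotient is at least the second
smallest eigenvalue. -/
theorem exists_second_last_le_rayleigh (hV : 2 ≤ Fintype.card V) (g h : V → ℝ) :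
    ∃ x y : ℝ, (x ≠ 0 ∨ y ≠ 0) ∧
      nthLargestEigenvalue hM (Fintype.card V - 1) * ((x • g + y • h) ⬝ᵥ (x • g + y • h)) ≤
        (x • g + y • h) ⬝ᵥ M *ᵥ (x • g + y • h) := by
  let e : Fin (Fintype.card V) ≃ V := Fintype.equivOfCardEq (Fintype.card_fin _)
  let i₀ : V := e ⟨Fintype.card V - 1, by omega⟩
  obtain ⟨x, y, hxy, h0⟩ := exists_combination_eq_zero (hM.eigenvectorBasis i₀ ⬝ᵥ g)
    (hM.eigenvectorBasis i₀ ⬝ᵥ h)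
  refine ⟨x, y, hxy, ?_⟩
  rw [hM.dotProduct_mulVec_eq_sum, hM.dotProduct_self_eq_sum, Finset.mul_sum]
  refine Finset.sum_le_sum fun i _ ↦ ?_
  by_cases hi : i = i₀
  · have : hM.eigenvectorBasis i ⬝ᵥ (x • g + y • h) = 0 := by
      rw [hi, dotProduct_add, dotProduct_smul, dotProduct_smul]
      exact h0
    rw [this]
    simp
  · refine mul_le_mul_of_nonneg_right ?_ (sq_nonneg _)
    rw [nthLargestEigenvalue, dif_pos ⟨by omega, by omega⟩]
    refine hM.eigenvalues₀_antitone (Fin.le_def.2 ?_)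
    have h1 : e.symm i ≠ ⟨Fintype.card V - 1, by omega⟩ := fun h ↦ hi (e.symm_apply_eq.1 h)
    have h2 : (e.symm i).1 ≠ Fintype.card V - 1 := fun h ↦ h1 (Fin.ext h)
    have h3 := (e.symm i).2
    change (e.symm i).1 ≤ Fintype.card V - 1 - 1
    omega

end

/-! ### Edges between vertex sets and across partitions. -/

namespace SimpleGraph

variable {V : Type*} (G : SimpleGraph V) [DecidableRel G.Adj]

/-- The number of pairs of adjacent vertices in `X × Y`. -/
noncomputable def cross (X Y : Finset V) : ℝ := ∑ v ∈ X, ∑ w ∈ Y, if G.Adj v w then 1 else 0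

theorem cross_nonneg (X Y : Finset V) : 0 ≤ G.cross X Y :=
  Finset.sum_nonneg fun v _ ↦ Finset.sum_nonneg fun w _ ↦ by split_ifs <;> norm_num

theorem cross_comm (X Y : Finset V) : G.cross X Y = G.cross Y X := by
  rw [cross, cross, Finset.sum_comm]
  simp only [G.adj_comm]

theorem cross_self_le [DecidableEq V] (X : Finset V) :
    G.cross X X ≤ X.card * ((X.card : ℝ) - 1) := by
  rw [cross, ← nsmul_eq_mul]
  refine Finset.sum_le_card_nsmul _ _ _ fun v hv ↦ ?_
  rw [← Finset.add_sum_erase _ _ hv, if_neg (G.loopless.irrefl v), zero_add]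
  calc ∑ w ∈ X.erase v, (if G.Adj v w then (1 : ℝ) else 0) ≤ (X.erase v).card • (1 : ℝ) :=
        Finset.sum_le_card_nsmul _ _ _ fun w _ ↦ by split_ifs <;> norm_num
    _ = X.card - 1 := by
        rw [Finset.card_erase_of_mem hv, nsmul_eq_mul, mul_one,
          Nat.cast_sub (Finset.card_pos.2 ⟨v, hv⟩), Nat.cast_one]

variable [Fintype V] [DecidableEq V]

theorem cross_add_cross_compl (X : Finset V) :
    G.cross X X + G.cross X Xᶜ = ∑ v ∈ X, (G.degree v : ℝ) := by
  rw [cross, cross, ← Finset.sum_add_distrib]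
  refine Finset.sum_congr rfl fun v _ ↦ ?_
  rw [Finset.sum_add_sum_compl]
  simp [← card_neighborFinset_eq_degree, neighborFinset_eq_filter]

/-- A nonempty set of vertices which few edges leave is large. -/
theorem lt_card_of_cross_compl_lt {X : Finset V} (hX : X.Nonempty)
    (h : G.cross X Xᶜ < G.minDegree) : G.minDegree + 1 ≤ X.card := by
  by_contra! hlt
  -- If 1 ≤ |X| ≤ δ, at least |X|(δ - |X| + 1) ≥ δ edges leave X.
  have h1 := G.cross_add_cross_compl X
  have h2 := G.cross_self_le X
  have h3 : (X.card : ℝ) * G.minDegree ≤ ∑ v ∈ X, (G.degree v : ℝ) := by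
    rw [← nsmul_eq_mul]
    exact Finset.card_nsmul_le_sum _ _ _ fun v _ ↦ by exact_mod_cast G.minDegree_le_degree v
  have h4 : (1 : ℝ) ≤ X.card := by exact_mod_cast hX.card_pos
  have h5 : (X.card : ℝ) ≤ G.minDegree := by exact_mod_cast Nat.le_of_lt_succ hlt
  nlinarith

/-- The indicator function of a set of vertices. -/
def ind (X : Finset V) : V → ℝ := fun v ↦ if v ∈ X then 1 else 0

open Matrix

theorem ind_dotProduct (X : Finset V) (g : V → ℝ) : ind X ⬝ᵥ g = ∑ v ∈ X, g v := by
  simp [ind, dotProduct]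

theorem ind_dotProduct_adjMatrix_mulVec (X Y : Finset V) :
    ind X ⬝ᵥ G.adjMatrix ℝ *ᵥ ind Y = G.cross X Y := by
  rw [ind_dotProduct, cross]
  refine Finset.sum_congr rfl fun v _ ↦ ?_
  rw [mulVec, dotProduct_comm, ind_dotProduct]
  simp only [adjMatrix_apply]

theorem ind_dotProduct_degMatrix_mulVec (X Y : Finset V) :
    ind X ⬝ᵥ G.degMatrix ℝ *ᵥ ind Y = ∑ v ∈ X ∩ Y, (G.degree v : ℝ) := by
  rw [ind_dotProduct]
  simp [degMatrix, mulVec_diagonal, ind]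

theorem ind_dotProduct_ind (X Y : Finset V) : ind X ⬝ᵥ ind Y = ((X ∩ Y).card : ℝ) := by
  rw [ind_dotProduct]
  simp [ind]

theorem combination_dotProduct_self {X Y : Finset V} (hXY : Disjoint X Y) (x y : ℝ) :
    (x • ind X + y • ind Y) ⬝ᵥ (x • ind X + y • ind Y) =
      x ^ 2 * X.card + y ^ 2 * Y.card := by
  simp only [add_dotProduct, dotProduct_add, smul_dotProduct, dotProduct_smul, smul_eq_mul,
    ind_dotProduct_ind, Finset.inter_self, Finset.disjoint_iff_inter_eq_empty.1 hXY,
    Finset.disjoint_iff_inter_eq_empty.1 hXY.symm, Finset.card_empty, Nat.cast_zero]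
  ring

theorem combination_dotProduct_degAdjMatrix {X Y : Finset V} (hXY : Disjoint X Y)
    (a b x y : ℝ) :
    (x • ind X + y • ind Y) ⬝ᵥ degAdjMatrix G a b *ᵥ (x • ind X + y • ind Y) =
      a * (x ^ 2 * ∑ v ∈ X, (G.degree v : ℝ) + y ^ 2 * ∑ v ∈ Y, (G.degree v : ℝ)) +
      b * (x ^ 2 * (∑ v ∈ X, (G.degree v : ℝ) - G.cross X Xᶜ) +
        y ^ 2 * (∑ v ∈ Y, (G.degree v : ℝ) - G.cross Y Yᶜ) + 2 * x * y * G.cross X Y) := by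
  rw [← G.cross_add_cross_compl X, ← G.cross_add_cross_compl Y]
  simp only [degAdjMatrix, add_mulVec, smul_mulVec, mulVec_add, mulVec_smul,
    add_dotProduct, dotProduct_add, smul_dotProduct, dotProduct_smul, smul_eq_mul,
    ind_dotProduct_adjMatrix_mulVec, ind_dotProduct_degMatrix_mulVec,
    Finset.inter_self, Finset.disjoint_iff_inter_eq_empty.1 hXY,
    Finset.disjoint_iff_inter_eq_empty.1 hXY.symm, Finset.sum_empty, G.cross_comm Y X,
    ← G.cross_add_cross_compl X, ← G.cross_add_cross_compl Y]
  ring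

/-- This is the handshake lemma for the graph of crossing edges. -/
theorem sum_cross_compl_eq (s : Setoid V) [Fintype (Quotient s)] [DecidableEq (Quotient s)] :
    ∑ q : Quotient s, G.cross (Finset.univ.filter fun v ↦ Quotient.mk s v = q)
      (Finset.univ.filter fun v ↦ Quotient.mk s v = q)ᶜ =
        2 * ((G \ classGraph s).edgeSet.ncard : ℝ) := by
  classical
  have h1 : ∀ q : Quotient s, G.cross (Finset.univ.filter fun v ↦ Quotient.mk s v = q)
      (Finset.univ.filter fun v ↦ Quotient.mk s v = q)ᶜ =
        ∑ v with Quotient.mk s v = q, ((G \ classGraph s).degree v : ℝ) := by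
    intro q
    refine Finset.sum_congr rfl fun v hv ↦ ?_
    rw [Finset.mem_filter_univ] at hv
    simp only [Finset.sum_boole]
    rw [← card_neighborFinset_eq_degree]
    congr 2
    ext w
    rw [Finset.mem_filter, Finset.mem_compl, Finset.mem_filter_univ, mem_neighborFinset, sdiff_adj,
      ← hv, and_comm]
    refine and_congr_right fun hvw ↦ not_congr ⟨fun h ↦ ⟨hvw.ne, (Quotient.exact h.symm)⟩,
      fun h ↦ (Quotient.sound h.2).symm⟩
  rw [Finset.sum_congr rfl fun q _ ↦ h1 q, Finset.sum_fiberwise, ← Nat.cast_sum,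
    sum_degrees_eq_twice_card_edges, ← coe_edgeFinset, Set.ncard_coe_finset, Nat.cast_mul,
    Nat.cast_two]
  congr!

theorem sum_cross_classes (s : Setoid V) [Fintype (Quotient s)] [DecidableEq (Quotient s)]
    (q : Quotient s) :
    ∑ q' ∈ Finset.univ.erase q, G.cross (Finset.univ.filter fun v ↦ Quotient.mk s v = q)
      (Finset.univ.filter fun v ↦ Quotient.mk s v = q') =
      G.cross (Finset.univ.filter fun v ↦ Quotient.mk s v = q)
      (Finset.univ.filter fun v ↦ Quotient.mk s v = q)ᶜ := by
  simp only [cross]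
  rw [Finset.sum_comm]
  refine Finset.sum_congr rfl fun v _ ↦ ?_
  have h1 := Finset.sum_fiberwise (s := Finset.univ) (fun w ↦ Quotient.mk s w)
    (fun w ↦ if G.Adj v w then (1 : ℝ) else 0)
  rw [← Finset.add_sum_erase _ _ (Finset.mem_univ q),
    ← Finset.sum_add_sum_compl (Finset.univ.filter fun w ↦ Quotient.mk s w = q)] at h1
  exact add_left_cancel h1

/-- If large sets that few edges leave are joined by many edges, then every partition is crossed
by many edges. -/
theorem lt_ncard_of_lt_cross {c : ℝ} (hc : 2 * c < G.minDegree) (hc0 : 0 < c)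
    (h : ∀ X Y : Finset V, Disjoint X Y → G.minDegree + 1 ≤ X.card → G.minDegree + 1 ≤ Y.card →
      G.cross X Xᶜ ≤ 2 * c → G.cross Y Yᶜ ≤ 2 * c →
      (2 * c - G.cross X Xᶜ) * (2 * c - G.cross Y Yᶜ) < G.cross X Y ^ 2)
    (s : Setoid V) (hs : 2 ≤ Nat.card (Quotient s)) :
    c * ((Nat.card (Quotient s) : ℝ) - 1) < (G \ classGraph s).edgeSet.ncard := by
  classical
  have := Fintype.ofFinite (Quotient s)
  rw [Nat.card_eq_fintype_card] at hs ⊢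
  by_contra! hle
  let X : Quotient s → Finset V := fun q ↦ Finset.univ.filter fun v ↦ Quotient.mk s v = q
  have hsum : ∑ q, G.cross (X q) (X q)ᶜ = 2 * ((G \ classGraph s).edgeSet.ncard : ℝ) :=
    G.sum_cross_compl_eq s
  have hne : ∀ q, (X q).Nonempty := fun q ↦ by
    obtain ⟨v, rfl⟩ := Quotient.exists_rep q
    exact ⟨v, by simp [X]⟩
  have hdisj : ∀ p q, p ≠ q → Disjoint (X p) (X q) := fun p q hpq ↦
    Finset.disjoint_left.2 fun v hp hq ↦ hpq (by
      rw [Finset.mem_filter_univ] at hp hq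
      exact hp.symm.trans hq)
  have : Nonempty (Quotient s) := Fintype.card_pos_iff.1 (by omega)
  -- A class of least boundary; by averaging, its boundary is below 2c.
  obtain ⟨p, -, hp⟩ := Finset.exists_min_image Finset.univ (fun q ↦ G.cross (X q) (X q)ᶜ)
    Finset.univ_nonempty
  have hcard : (2 : ℝ) ≤ Fintype.card (Quotient s) := by exact_mod_cast hs
  have hp2 : G.cross (X p) (X p)ᶜ < 2 * c := by
    by_contra! hcon
    have h1 : (Fintype.card (Quotient s)) • (2 * c) ≤ ∑ q, G.cross (X q) (X q)ᶜ :=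
      Finset.card_nsmul_le_sum _ _ _ fun q hq ↦ hcon.trans (hp q hq)
    rw [nsmul_eq_mul] at h1
    nlinarith
  have hq : ∀ q ∈ Finset.univ.erase p,
      2 * c < G.cross (X q) (X q)ᶜ + G.cross (X p) (X q) := by
    intro q hq
    have h0 := G.cross_nonneg (X p) (X q)
    rcases lt_or_ge (2 * c) (G.cross (X q) (X q)ᶜ) with h1 | h1
    · linarith
    · have h2 := h (X p) (X q) (hdisj p q (Finset.ne_of_mem_erase hq).symm)
        (G.lt_card_of_cross_compl_lt (hne p) (by linarith))
        (G.lt_card_of_cross_compl_lt (hne q) (by linarith)) hp2.le h1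
      have h3 := hp q (Finset.mem_univ q)
      by_contra! hcon
      -- Minimality of `p` gives 2c - r(q) ≤ 2c - r(p), so (2c - r(q))² is at most the product
      -- bounded in `h2`, and hence 2c - r(q) < e(p,q).
      nlinarith
  have hne' : (Finset.univ.erase p).Nonempty := by
    rw [← Finset.card_pos, Finset.card_erase_of_mem (Finset.mem_univ _), Finset.card_univ]
    omega
  have hlt := Finset.sum_lt_sum_of_nonempty hne' hq
  rw [Finset.sum_const, Finset.card_erase_of_mem (Finset.mem_univ _), Finset.card_univ,
    nsmul_eq_mul, Nat.cast_sub (by omega), Nat.cast_one, Finset.sum_add_distrib] at hlt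
  have hcross : ∑ q ∈ Finset.univ.erase p, G.cross (X p) (X q) = G.cross (X p) (X p)ᶜ :=
    G.sum_cross_classes s p
  rw [hcross, Finset.sum_erase_add _ (fun q ↦ G.cross (X q) (X q)ᶜ) (Finset.mem_univ p),
    hsum] at hlt
  nlinarith

end SimpleGraph

/-! ### From eigenvalue bounds to the partition condition. -/

/-- An indefinite binary quadratic form has a large off-diagonal coefficient. -/
theorem mul_lt_sq_of_quadratic_le {p q e x y P Q : ℝ} (hP : 0 ≤ P) (hQ : 0 ≤ Q) (hp : P < p)
    (hq : Q < q) (hxy : x ≠ 0 ∨ y ≠ 0) (h : p * x ^ 2 + q * y ^ 2 + 2 * e * x * y ≤ 0) :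
    P * Q < e ^ 2 := by
  have h1 : P * Q < p * q := by nlinarith
  by_contra! hcon
  have hlt : 0 < p * q - e ^ 2 := by linarith
  have hp0 : 0 < p := by linarith
  -- The form multiplied by `p`, with the square completed.
  have h2 : (p * x + e * y) ^ 2 + (p * q - e ^ 2) * y ^ 2 ≤ 0 := by
    have := mul_nonpos_of_nonneg_of_nonpos hp0.le h
    linarith
  have hy : y = 0 := by
    by_contra hy
    have := mul_pos hlt (pow_pos (abs_pos.2 hy) 2)
    rw [sq_abs] at this
    nlinarith [sq_nonneg (p * x + e * y)]
  subst hy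
  have hx : x ≠ 0 := hxy.resolve_right (by simp)
  have : 0 < p * x ^ 2 := by positivity
  linarith

/-- The numerical core of the eigenvalue argument. -/
theorem mul_lt_sq_of_rayleigh {m b δ c l x y nX nY rX rY e : ℝ} (hb : 0 < b) (hδ : 0 ≤ δ)
    (hc : 0 ≤ c) (hl : l < m + b * δ - 2 * b * c / (δ + 1)) (hxy : x ≠ 0 ∨ y ≠ 0)
    (hX : δ + 1 ≤ nX) (hY : δ + 1 ≤ nY) (hrX : rX ≤ 2 * c) (hrY : rY ≤ 2 * c)
    (h : x ^ 2 * ((m + b * δ) * nX - b * rX) + y ^ 2 * ((m + b * δ) * nY - b * rY) +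
      2 * b * x * y * e ≤ l * (x ^ 2 * nX + y ^ 2 * nY)) :
    (2 * c - rX) * (2 * c - rY) < e ^ 2 := by
  have hδ1 : 0 < δ + 1 := by linarith
  -- After division by `b`, the form has diagonal coefficients t·n - r, and the bound on `l` says
  -- exactly t(δ+1) > 2c.
  obtain ⟨t, ht⟩ : ∃ t, m + b * δ - l = b * t := ⟨(m + b * δ - l) / b, by field_simp⟩
  have h1 : 2 * c < t * (δ + 1) := by
    have h2 : 2 * b * c / (δ + 1) < b * t := by linarith
    rw [div_lt_iff₀ hδ1] at h2
    have h3 : b * (2 * c) < b * (t * (δ + 1)) := by linarith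
    exact lt_of_mul_lt_mul_left h3 hb.le
  have ht0 : 0 < t := by
    by_contra! hcon
    nlinarith
  have hp : ∀ n, δ + 1 ≤ n → 2 * c < t * n := fun n hn ↦
    h1.trans_le (mul_le_mul_of_nonneg_left hn ht0.le)
  refine mul_lt_sq_of_quadratic_le (p := t * nX - rX) (q := t * nY - rY) (by linarith)
    (by linarith) (by linarith [hp nX hX]) (by linarith [hp nY hY]) hxy ?_
  have hm : m + b * δ = b * t + l := by linarith
  rw [hm] at h
  refine nonpos_of_mul_nonpos_right (a := b) ?_ hb
  linarith

theorem two_le_card_of_minDegree_pos {V : Type*} [Fintype V] (G : SimpleGraph V)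
    [DecidableRel G.Adj] (h : 1 ≤ G.minDegree) : 2 ≤ Fintype.card V := by
  by_contra! hV
  have : Subsingleton V := Fintype.card_le_one_iff_subsingleton.1 (by omega)
  have := G.minDegree_of_subsingleton
  omega

open Matrix SimpleGraph in
-- The parameters serve both signs of b: m = aδ with l = λ₂ for b > 0, and, after negating the
-- matrix, m = -aΔ with l = -λₙ₋₁ for b < 0. The hypothesis δ ≥ 2k+2 ensures 2c < δ.
theorem propertyP_of_rayleigh {V : Type*} [Fintype V] [DecidableEq V] (G : SimpleGraph V)
    [DecidableRel G.Adj] {k : ℕ} (hk : 1 ≤ k) (hδ : 2 * k + 2 ≤ G.minDegree) {m b l : ℝ}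
    (hb : 0 < b)
    (hl : l < m + b * G.minDegree -
      2 * b * (k + ((G.minDegree : ℝ) - 1) / G.minDegree) / (G.minDegree + 1))
    (h : ∀ X Y : Finset V, Disjoint X Y → ∃ x y : ℝ, (x ≠ 0 ∨ y ≠ 0) ∧
      x ^ 2 * ((m + b * G.minDegree) * X.card - b * G.cross X Xᶜ) +
        y ^ 2 * ((m + b * G.minDegree) * Y.card - b * G.cross Y Yᶜ) +
        2 * b * x * y * G.cross X Y ≤ l * (x ^ 2 * X.card + y ^ 2 * Y.card)) :
    PropertyP G k G.minDegree := by
  have hd4 : (4 : ℝ) ≤ G.minDegree := by exact_mod_cast (by omega : 4 ≤ G.minDegree)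
  have hdk : 2 * (k : ℝ) + 2 ≤ G.minDegree := by exact_mod_cast hδ
  have hr0 : 0 ≤ ((G.minDegree : ℝ) - 1) / G.minDegree := div_nonneg (by linarith) (by linarith)
  have hr1 : ((G.minDegree : ℝ) - 1) / G.minDegree < 1 := by
    rw [div_lt_one (by linarith)]
    linarith
  have hk1 : (1 : ℝ) ≤ k := by exact_mod_cast hk
  have hV := two_le_card_of_minDegree_pos G (by omega)
  refine propertyP_of_forall_setoid (by omega) hV
    (G.lt_ncard_of_lt_cross (by linarith) (by linarith) fun X Y hXY hX hY hrX hrY ↦ ?_)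
  obtain ⟨x, y, hxy, hle⟩ := h X Y hXY
  exact mul_lt_sq_of_rayleigh hb (by linarith) (by linarith) hl hxy (by exact_mod_cast hX)
    (by exact_mod_cast hY) hrX hrY hle

open Matrix SimpleGraph in
theorem propertyP_of_second_eigenvalue_lt {V : Type*} [Fintype V] [DecidableEq V]
    (G : SimpleGraph V) [DecidableRel G.Adj] {k : ℕ} (hk : 1 ≤ k) (hδ : 2 * k + 2 ≤ G.minDegree)
    {a b : ℝ} (ha : 0 ≤ a) (hb : 0 < b)
    (h : lam G a b 2 < (a + b) * G.minDegree -
      2 * b * (k + ((G.minDegree : ℝ) - 1) / G.minDegree) / (G.minDegree + 1)) :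
    PropertyP G k G.minDegree := by
  refine propertyP_of_rayleigh G hk hδ (m := a * G.minDegree) hb
    (by rwa [add_mul] at h) fun X Y hXY ↦ ?_
  obtain ⟨x, y, hxy, hle⟩ := exists_rayleigh_le_second (degAdjMatrix_isHermitian G a b)
    (two_le_card_of_minDegree_pos G (by omega)) (ind X) (ind Y)
  refine ⟨x, y, hxy, ?_⟩
  rw [combination_dotProduct_self hXY, combination_dotProduct_degAdjMatrix G hXY] at hle
  have hvol : ∀ Z : Finset V, (Z.card : ℝ) * G.minDegree ≤ ∑ v ∈ Z, (G.degree v : ℝ) := by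
    intro Z
    rw [← nsmul_eq_mul]
    exact Finset.card_nsmul_le_sum _ _ _ fun v _ ↦ by exact_mod_cast G.minDegree_le_degree v
  have h1 := mul_le_mul_of_nonneg_left (hvol X) (mul_nonneg (add_nonneg ha hb.le) (sq_nonneg x))
  have h2 := mul_le_mul_of_nonneg_left (hvol Y) (mul_nonneg (add_nonneg ha hb.le) (sq_nonneg y))
  rw [lam]
  linarith

open Matrix SimpleGraph in
theorem propertyP_of_lt_second_last_eigenvalue {V : Type*} [Fintype V] [DecidableEq V]
    (G : SimpleGraph V) [DecidableRel G.Adj] {k : ℕ} (hk : 1 ≤ k) (hδ : 2 * k + 2 ≤ G.minDegree)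
    {a b : ℝ} (ha : 0 ≤ a) (hb : b < 0)
    (h : a * G.maxDegree + b * G.minDegree -
      2 * b * (k + ((G.minDegree : ℝ) - 1) / G.minDegree) / (G.minDegree + 1) <
        lam G a b (Fintype.card V - 1)) :
    PropertyP G k G.minDegree := by
  refine propertyP_of_rayleigh G hk hδ (m := -(a * G.maxDegree)) (neg_pos.2 hb)
    (l := -lam G a b (Fintype.card V - 1)) ?_ fun X Y hXY ↦ ?_
  · have : 2 * -b * (k + ((G.minDegree : ℝ) - 1) / G.minDegree) / (G.minDegree + 1) =
        -(2 * b * (k + ((G.minDegree : ℝ) - 1) / G.minDegree) / (G.minDegree + 1)) := by ring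
    rw [this]
    linarith
  obtain ⟨x, y, hxy, hle⟩ := exists_second_last_le_rayleigh (degAdjMatrix_isHermitian G a b)
    (two_le_card_of_minDegree_pos G (by omega)) (ind X) (ind Y)
  refine ⟨x, y, hxy, ?_⟩
  rw [combination_dotProduct_self hXY, combination_dotProduct_degAdjMatrix G hXY] at hle
  have hvol : ∀ Z : Finset V, (Z.card : ℝ) * G.minDegree ≤ ∑ v ∈ Z, (G.degree v : ℝ) := by
    intro Z
    rw [← nsmul_eq_mul]
    exact Finset.card_nsmul_le_sum _ _ _ fun v _ ↦ by exact_mod_cast G.minDegree_le_degree v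
  have hvol' : ∀ Z : Finset V, ∑ v ∈ Z, (G.degree v : ℝ) ≤ (Z.card : ℝ) * G.maxDegree := by
    intro Z
    rw [← nsmul_eq_mul]
    exact Finset.sum_le_card_nsmul _ _ _ fun v _ ↦ by exact_mod_cast G.degree_le_maxDegree v
  have h1 := mul_le_mul_of_nonneg_left (hvol X) (mul_nonneg (neg_pos.2 hb).le (sq_nonneg x))
  have h2 := mul_le_mul_of_nonneg_left (hvol Y) (mul_nonneg (neg_pos.2 hb).le (sq_nonneg y))
  -- After negation the degree term has coefficient -a ≤ 0, so degrees are bounded above by Δ here,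
  -- while the adjacency term still uses δ.
  have h3 := mul_le_mul_of_nonneg_left (hvol' X) (mul_nonneg ha (sq_nonneg x))
  have h4 := mul_le_mul_of_nonneg_left (hvol' Y) (mul_nonneg ha (sq_nonneg y))
  rw [lam]
  linarith

theorem corollary5p2 {V : Type*} [Fintype V] [DecidableEq V] (G : SimpleGraph V)
    [DecidableRel G.Adj] (k δ Δ : ℕ) (hk : 1 ≤ k)
    (hmin : G.minDegree = δ) (hmax : G.maxDegree = Δ) (hδ : 2 * k + 2 ≤ δ)
    (a : ℝ) (ha : 0 ≤ a) :
    (lam G a 1 2 < (a + 1) * δ - 2 * (k + ((δ : ℝ) - 1) / δ) / (δ + 1) → PropertyP G k δ) ∧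
    (∀ b : ℝ, 0 < b →
      lam G a b 2 < (a + b) * δ - 2 * b * (k + ((δ : ℝ) - 1) / δ) / (δ + 1) →
      PropertyP G k δ) ∧
    (∀ b : ℝ, b < 0 →
      lam G a b (Fintype.card V - 1) >
        a * Δ + b * δ - 2 * b * (k + ((δ : ℝ) - 1) / δ) / (δ + 1) →
      PropertyP G k δ) := by
  subst hmin hmax
  refine ⟨fun h ↦ ?_, fun b hb h ↦ ?_, fun b hb h ↦ ?_⟩
  · exact propertyP_of_second_eigenvalue_lt G hk hδ ha one_pos (by rwa [mul_one])
  · exact propertyP_of_second_eigenvalue_lt G hk hδ ha hb h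
  · exact propertyP_of_lt_second_last_eigenvalue G hk hδ ha hb h
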